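/- Notation. $M_n$ is the space of complex $n\times n$ matrices, and for $T\in \mathrm{GL}(n,\mathbb{C})$ we write $\mathrm{Ad}_T A:=TAT^{-1}$. A map $\phi:\mathrm{SU}(n)\to M_n$ is *spectrum-preserving* if $X$ and $\phi(X)$ have the same set of eigenvalues for every $X$, *commutativity-preserving* if $\phi(X)\phi(Y)=\phi(Y)\phi(X)$ whenever $XY=YX$, and *CS-preserving* if it is both. For $X\in \mathrm{SU}(n)$ there are unique real numbers $$x_1\le x_2\le\cdots\le x_n\le x_1+1,\qquad \sum_{j} x_j=0,$$ such that $\exp(2\pi i x_1),\dots,\exp(2\pi i x_n)$ are the eigenvalues of $X$ counted with multiplicity; put $\lambda_j(X):=\exp(2\pi i x_j)$. A *maximal torus* of $\mathrm{SU}(n)$ is a subgroup which is isomorphic, as a topological group, to a finite power of the circle group, and which is maximal among such subgroups. We say that $\phi$ *reorders* on a maximal torus $\mathbb{T}$ if there is $T\in\mathrm{GL}(n,\mathbb{C})$ with $$\phi(X)=\mathrm{Ad}_T\,\mathrm{diag}(\lambda_1(X),\dots,\lambda_n(X))\qquad\text{for all } X\in\mathbb{T}.$$ **Proposition.** (1)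 Let $n\ge 3$ and let $\phi:\mathrm{SU}(n)\to M_n$ be continuous and CS-preserving. If $\phi$ reorders on at least one maximal torus of $\mathrm{SU}(n)$, then there is $T\in\mathrm{GL}(n,\mathbb{C})$ such that $$\phi(X)=\mathrm{Ad}_T\,\mathrm{diag}(\lambda_1(X),\dots,\lambda_n(X))\qquad\text{for all } X\in\mathrm{SU}(n).$$ (2) This fails for $n=2$: maximal tori of $\mathrm{SU}(2)$ exist, and there is a continuous CS-preserving map $\phi:\mathrm{SU}(2)\to M_2$ which reorders on every maximal torus of $\mathrm{SU}(2)$, but for which no $T\in\mathrm{GL}(2,\mathbb{C})$ satisfies $\phi(X)=\mathrm{Ad}_T\,\mathrm{diag}(\lambda_1(X),\lambda_2(X))$ for all $X\in\mathrm{SU}(2)$. -/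

import Mathlib

/-- The special unitary group `SU(n)`, with the topology it inherits from `M_n(ℂ)`. -/
abbrev SU (n : ℕ) : Type := Matrix.specialUnitaryGroup (Fin n) ℂ

/-- The matrix space `M_n = M_n(ℂ)`, with its usual topology. -/
abbrev Mat (n : ℕ) : Type := Matrix (Fin n) (Fin n) ℂ

/-- The conjugation `Ad_T : A ↦ T A T⁻¹` by an invertible matrix `T`. -/
def conjBy {n : ℕ} (T : GL (Fin n) ℂ) (A : Mat n) : Mat n :=
  (T : Mat n) * A * ((T⁻¹ : GL (Fin n) ℂ) : Mat n)

/-- `φ : SU(n) → M_n` preserves commutativity. -/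
def CommutativityPreserving {n : ℕ} (φ : SU n → Mat n) : Prop :=
  ∀ X Y : SU n, X * Y = Y * X → φ X * φ Y = φ Y * φ X

/-- `φ : SU(n) → M_n` preserves spectra (as sets). -/
def SpectrumPreserving {n : ℕ} (φ : SU n → Mat n) : Prop :=
  ∀ X : SU n, spectrum ℂ (φ X) = spectrum ℂ (X : Mat n)

/-- A subgroup of a topological group is a torus if it is isomorphic, as a topological group, to a
finite power of the circle group. -/
def IsTorus {G : Type*} [Group G] [TopologicalSpace G] (H : Subgroup G) : Prop :=
  ∃ k : ℕ, Nonempty (H ≃ₜ* (Fin k → Circle))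

/-- A maximal torus: a torus that is not properly contained in another torus. -/
def IsMaximalTorus {G : Type*} [Group G] [TopologicalSpace G] (H : Subgroup G) : Prop :=
  Maximal IsTorus H

/-- `x` is a tuple of normalized spectral angles of `X`: it is non-decreasing, all of its entries
lie within distance one of each other (for a non-decreasing tuple, this is `x_n ≤ x_1 + 1`), its sum
is zero, and the numbers `exp(2πi x_j)` are the eigenvalues of `X`, counted with their algebraic
multiplicities. -/
structure IsSpectralAngles {n : ℕ} (X : Mat n) (x : Fin n → ℝ) : Prop where
  mono : Monotone x
  width : ∀ i j, x j ≤ x i + 1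
  sum_eq_zero : ∑ j, x j = 0
  spec : X.charpoly.roots =
    Finset.univ.val.map (fun j => Complex.exp (2 * Real.pi * Complex.I * (x j : ℂ)))

theorem map_univ_val_eq_iff {α : Type*} {n : ℕ} (f g : Fin n → α) :
    Finset.univ.val.map f = Finset.univ.val.map g ↔ ∃ σ : Equiv.Perm (Fin n), f = g ∘ σ := by
  classical
  constructor
  · intro h
    have hc : ∀ c : α, Nonempty ({a // f a = c} ≃ {b // g b = c}) := by
      intro c
      refine ⟨Fintype.equivOfCardEq ?_⟩
      have h1 := congrArg (Multiset.count c) h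
      rw [Multiset.count_map, Multiset.count_map] at h1
      rw [Fintype.card_subtype, Fintype.card_subtype]
      simp only [eq_comm (a := c)] at h1
      exact h1
    refine ⟨Equiv.ofFiberEquiv fun c => (hc c).some, ?_⟩
    ext a
    exact (Equiv.ofFiberEquiv_map (fun c => (hc c).some) a).symm
  · rintro ⟨σ, rfl⟩
    rw [← Multiset.map_map, Multiset.map_univ_val_equiv]

theorem exists_tuple_of_card {α : Type*} {n : ℕ} (s : Multiset α) (hs : s.card = n) :
    ∃ z : Fin n → α, s = Finset.univ.val.map z := by
  subst hs
  refine ⟨fun i => s.toList.get (i.cast (by simp)), ?_⟩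
  rw [Fin.univ_val_map]
  conv_lhs => rw [← Multiset.coe_toList s]
  congr 1
  apply List.ext_get <;> simp

theorem exists_angle {z : ℂ} (hz : ‖z‖ = 1) :
    ∃ y : ℝ, 0 ≤ y ∧ y < 1 ∧ Complex.exp (2 * Real.pi * Complex.I * (y : ℂ)) = z := by
  refine ⟨Int.fract (z.arg / (2 * Real.pi)), Int.fract_nonneg _, Int.fract_lt_one _, ?_⟩
  have hpi : (Real.pi : ℂ) ≠ 0 := by exact_mod_cast Real.pi_ne_zero
  rw [← Int.self_sub_floor]
  have h1 : 2 * Real.pi * Complex.I *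
      ((z.arg / (2 * Real.pi) - ⌊z.arg / (2 * Real.pi)⌋ : ℝ) : ℂ)
      = z.arg * Complex.I - ⌊z.arg / (2 * Real.pi)⌋ * (2 * Real.pi * Complex.I) := by
    push_cast
    field_simp
  rw [h1, Complex.exp_sub, Complex.exp_int_mul_two_pi_mul_I, div_one]
  have := Complex.norm_mul_exp_arg_mul_I z
  rwa [hz, Complex.ofReal_one, one_mul] at this

theorem exists_normalized_angles {n : ℕ} (z : Fin n → ℂ) (hz : ∀ i, ‖z i‖ = 1)
    (hp : ∏ i, z i = 1) :
    ∃ x : Fin n → ℝ, Monotone x ∧ (∀ i j, x j ≤ x i + 1) ∧ ∑ j, x j = 0 ∧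
      Finset.univ.val.map z =
        Finset.univ.val.map (fun j => Complex.exp (2 * Real.pi * Complex.I * (x j : ℂ))) := by
  have hpi : (Real.pi : ℂ) ≠ 0 := by exact_mod_cast Real.pi_ne_zero
  choose y hy0 hy1 hyz using fun i => exists_angle (hz i)
  obtain ⟨m, hm⟩ : ∃ m : ℤ, ∑ i, y i = m := by
    have h : Complex.exp (2 * Real.pi * Complex.I * ((∑ i, y i : ℝ) : ℂ)) = 1 := by
      push_cast
      rw [Finset.mul_sum, Complex.exp_sum, ← hp]
      exact Finset.prod_congr rfl fun i _ => hyz i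
    obtain ⟨m, hm⟩ := Complex.exp_eq_one_iff.1 h
    refine ⟨m, ?_⟩
    have h2 : ((∑ i, y i : ℝ) : ℂ) = (m : ℂ) := by
      have h3 : (2 * Real.pi * Complex.I : ℂ) ≠ 0 := by simp [hpi]
      apply mul_left_cancel₀ h3
      rw [hm]; ring
    exact_mod_cast h2
  have hm0 : 0 ≤ m := by
    have : (0 : ℝ) ≤ m := hm ▸ Finset.sum_nonneg fun i _ => hy0 i
    exact_mod_cast this
  have hmn : m ≤ n := by
    have : (m : ℝ) ≤ n := by
      rw [← hm]
      calc ∑ i, y i ≤ ∑ _i : Fin n, (1 : ℝ) := Finset.sum_le_sum fun i _ => (hy1 i).le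
        _ = n := by simp
    exact_mod_cast this
  lift m to ℕ using hm0
  have hmn' : m ≤ n := by exact_mod_cast hmn
  set σ := Tuple.sort y with hσ
  have hmono : Monotone (y ∘ σ) := Tuple.monotone_sort y
  let w : Fin n → ℝ := fun j => if n - m ≤ (j : ℕ) then y (σ j) - 1 else y (σ j)
  have hw : ∀ i j, w j ≤ w i + 1 := by
    intro i j
    have a1 := hy0 (σ i)
    have a2 := hy1 (σ i)
    have a3 := hy0 (σ j)
    have a4 := hy1 (σ j)
    by_cases hi : n - m ≤ (i : ℕ) <;> by_cases hj : n - m ≤ (j : ℕ) <;>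
      simp only [w, hi, hj, if_true, if_false] <;> try linarith
    have : y (σ j) ≤ y (σ i) := hmono (show j ≤ i from Fin.le_def.2 (by omega))
    linarith
  have hcard : (Finset.univ.filter fun j : Fin n => n - m ≤ (j : ℕ)).card = m := by
    have h1 := Fin.card_filter_val_lt (n := n) (m := n - m)
    have h2 := Finset.card_filter_add_card_filter_not (s := (Finset.univ : Finset (Fin n)))
      (fun j : Fin n => (j : ℕ) < n - m)
    simp only [not_lt, Finset.card_univ, Fintype.card_fin] at h2
    omega
  have hsum : ∑ j, w j = 0 := by
    have h1 : ∀ j, w j = y (σ j) - if n - m ≤ (j : ℕ) then 1 else 0 := by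
      intro j; simp only [w]; split_ifs <;> simp
    simp only [h1, Finset.sum_sub_distrib, Finset.sum_boole]
    rw [hcard, Equiv.sum_comp σ y, hm]; simp
  have hexp : ∀ j, Complex.exp (2 * Real.pi * Complex.I * (w j : ℂ)) = z (σ j) := by
    intro j
    rw [← hyz (σ j)]
    simp only [w]
    split_ifs
    · push_cast
      rw [mul_sub, Complex.exp_sub, mul_one, Complex.exp_two_pi_mul_I, div_one]
    · rfl
  refine ⟨w ∘ Tuple.sort w, Tuple.monotone_sort w, fun i j => hw _ _, ?_, ?_⟩
  · rw [← hsum]; exact Equiv.sum_comp (Tuple.sort w) w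
  · simp only [Function.comp_apply, hexp]
    rw [map_univ_val_eq_iff]
    exact ⟨(σ.symm.trans (Tuple.sort w).symm), by ext j; simp⟩

theorem normalized_angles_unique {n : ℕ} {x x' : Fin n → ℝ}
    (hx : Monotone x) (hx' : Monotone x') (hw : ∀ i j, x j ≤ x i + 1)
    (hw' : ∀ i j, x' j ≤ x' i + 1) (hs : ∑ j, x j = 0) (hs' : ∑ j, x' j = 0)
    (h : Finset.univ.val.map (fun j => Complex.exp (2 * Real.pi * Complex.I * (x j : ℂ))) =
      Finset.univ.val.map (fun j => Complex.exp (2 * Real.pi * Complex.I * (x' j : ℂ)))) :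
    x = x' := by
  have hpi : (Real.pi : ℂ) ≠ 0 := by exact_mod_cast Real.pi_ne_zero
  obtain ⟨σ, hσ⟩ := (map_univ_val_eq_iff _ _).1 h
  have hk : ∀ j, ∃ k : ℤ, x j = x' (σ j) + k := by
    intro j
    have h1 := congrFun hσ j
    simp only [Function.comp_apply] at h1
    obtain ⟨k, hk⟩ := Complex.exp_eq_exp_iff_exists_int.1 h1
    refine ⟨k, ?_⟩
    have h3 : (2 * Real.pi * Complex.I : ℂ) ≠ 0 := by simp [hpi]
    have : (x j : ℂ) = x' (σ j) + k := by
      apply mul_left_cancel₀ h3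
      rw [hk]; ring
    exact_mod_cast this
  choose k hk using hk
  have hksum : ∑ j, k j = 0 := by
    have : ∑ j, (k j : ℝ) = 0 := by
      have h1 : ∑ j, x j = ∑ j, x' (σ j) + ∑ j, (k j : ℝ) := by
        rw [← Finset.sum_add_distrib]; exact Finset.sum_congr rfl fun j _ => hk j
      rw [Equiv.sum_comp σ x', hs, hs'] at h1
      linarith
    exact_mod_cast this
  -- a positive and a negative integer shift force all the entries involved
  have key : ∀ i j, 0 < k i → k j < 0 →
      k i = 1 ∧ k j = -1 ∧ x i = x j + 1 := by
    intro i j hi hj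
    have b1 := hw j i
    have b2 := hw' (σ i) (σ j)
    have e1 := hk i
    have e2 := hk j
    have hle : k i - k j ≤ 2 := by
      have : ((k i - k j : ℤ) : ℝ) ≤ 2 := by push_cast; linarith
      exact_mod_cast this
    have hi1 : k i = 1 := by omega
    have hj1 : k j = -1 := by omega
    refine ⟨hi1, hj1, ?_⟩
    rw [hi1] at e1; rw [hj1] at e2
    push_cast at e1 e2
    linarith
  have hperm : ∃ τ : Equiv.Perm (Fin n), x = (x' ∘ σ) ∘ τ := by
    rw [← map_univ_val_eq_iff]
    by_cases hz : ∀ j, k j = 0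
    · congr 1; ext j; simp [hk j, hz j]
    · push Not at hz
      obtain ⟨p, hp⟩ : ∃ p, 0 < k p := by
        by_contra! hc
        obtain ⟨j, hj⟩ := hz
        exact hj ((Finset.sum_eq_zero_iff_of_nonpos fun i _ => hc i).1 hksum j (Finset.mem_univ j))
      obtain ⟨q, hq⟩ : ∃ q, k q < 0 := by
        by_contra! hc
        obtain ⟨j, hj⟩ := hz
        exact hj ((Finset.sum_eq_zero_iff_of_nonneg fun i _ => hc i).1 hksum j (Finset.mem_univ j))
      have hpq := (key p q hp hq).2.2
      have hstep : ∀ (f : ℝ → ℤ) (j : Fin n),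
          f (x j) - f (x' (σ j)) = k j * (f (x p) - f (x q)) := by
        intro f j
        have e := hk j
        rcases lt_trichotomy (k j) 0 with hj | hj | hj
        · obtain ⟨-, b, c⟩ := key p j hp hj
          rw [b] at e ⊢
          push_cast at e
          have e1 : x j = x q := by linarith
          have e2 : x' (σ j) = x p := by linarith
          rw [e1, e2]; ring
        · rw [hj] at e ⊢
          push_cast at e
          rw [e]; simp
        · obtain ⟨b, -, c⟩ := key j q hj hq
          rw [b] at e ⊢
          push_cast at e
          have e1 : x j = x p := by linarith
          have e2 : x' (σ j) = x q := by linarith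
          rw [e1, e2]; ring
      ext c
      have hc : ∑ j, ((if c = x j then 1 else 0 : ℤ) - if c = x' (σ j) then 1 else 0) = 0 := by
        rw [Finset.sum_congr rfl fun j _ => hstep (fun t => if c = t then 1 else 0) j,
          ← Finset.sum_mul, hksum, zero_mul]
      rw [Finset.sum_sub_distrib, Finset.sum_boole, Finset.sum_boole, sub_eq_zero] at hc
      rw [Multiset.count_map, Multiset.count_map]
      exact_mod_cast hc
  obtain ⟨τ, hτ⟩ := hperm
  have h1 : x = x' ∘ (τ.trans σ) := by rw [hτ]; rfl
  have h2 := Tuple.unique_monotone (f := x') (σ := τ.trans σ) (τ := 1)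
    (h1 ▸ hx) (by simpa using hx')
  rw [h1, h2]; rfl

open scoped Matrix.Norms.L2Operator in
theorem norm_eigenvalue_eq_one {n : ℕ} (X : SU n) {z : ℂ} (hz : z ∈ (X : Mat n).charpoly.roots) :
    ‖z‖ = 1 := by
  have hroot : z ∈ spectrum ℂ (X : Mat n) :=
    Matrix.mem_spectrum_iff_isRoot_charpoly.2 (Polynomial.isRoot_of_mem_roots hz)
  exact spectrum.norm_eq_one_of_unitary
    (Matrix.specialUnitaryGroup_le_unitaryGroup X.2) hroot

/-- Every special unitary matrix has exactly one tuple of normalized spectral angles. -/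
theorem existsUnique_spectralAngles {n : ℕ} (X : SU n) :
    ∃! x : Fin n → ℝ, IsSpectralAngles (X : Mat n) x := by
  have hcard : (X : Mat n).charpoly.roots.card = n := by
    rw [IsAlgClosed.card_roots_eq_natDegree, Matrix.charpoly_natDegree_eq_dim, Fintype.card_fin]
  obtain ⟨z, hz⟩ := exists_tuple_of_card _ hcard
  obtain ⟨x, h1, h2, h3, h4⟩ := exists_normalized_angles z
    (fun i => norm_eigenvalue_eq_one X (by rw [hz]; simp))
    (by
      have hd := Matrix.det_eq_prod_roots_charpoly (X : Mat n)
      rw [(Matrix.mem_specialUnitaryGroup_iff.1 X.2).2, hz] at hd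
      exact hd.symm)
  refine ⟨x, ⟨h1, h2, h3, hz.trans h4⟩, fun x' hx' => ?_⟩
  exact normalized_angles_unique hx'.mono h1 hx'.width h2 hx'.sum_eq_zero h3
    (hx'.spec.symm.trans (hz.trans h4))

/-- The unique `x_1 ≤ ⋯ ≤ x_n ≤ x_1 + 1` with sum zero for which the `exp(2πi x_j)` constitute the
spectrum of `X ∈ SU(n)`. -/
noncomputable def spectralAngles {n : ℕ} (X : SU n) : Fin n → ℝ :=
  (existsUnique_spectralAngles X).choose

theorem spectralAngles_spec {n : ℕ} (X : SU n) :
    IsSpectralAngles (X : Mat n) (spectralAngles X) :=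
  (existsUnique_spectralAngles X).choose_spec.1

/-- The spectral selection `λ_j(X) = exp(2πi x_j)`. -/
noncomputable def spectralSelection {n : ℕ} (X : SU n) (j : Fin n) : ℂ :=
  Complex.exp (2 * Real.pi * Complex.I * (spectralAngles X j : ℂ))

/-- `φ` is a reordering on the subgroup `H` (used for a maximal torus `H`): its restriction to `H`
is of the form `X ↦ Ad_T diag(λ_1(X), …, λ_n(X))` for one invertible matrix `T`. -/
def ReordersOn {n : ℕ} (φ : SU n → Mat n) (H : Subgroup (SU n)) : Prop :=
  ∃ T : GL (Fin n) ℂ, ∀ X ∈ H, φ X = conjBy T (Matrix.diagonal (spectralSelection X))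

/-- `φ` is globally of spectral-selection type: it has the form `X ↦ Ad_T diag(λ_1(X), …, λ_n(X))` on
all of `SU(n)`, for one invertible matrix `T`. -/
def IsSelectionType {n : ℕ} (φ : SU n → Mat n) : Prop :=
  ∃ T : GL (Fin n) ℂ, ∀ X : SU n, φ X = conjBy T (Matrix.diagonal (spectralSelection X))

/-! After conjugations, `φ X = diag(λ(X))` on the diagonal torus. Consider the unitary matrices
`U` for which `φ (U t U*) = diag(λ(t))` for every diagonal `t`, and let `R` be a rotation of the
`(a, b)` coordinate plane. A diagonal `r` with `r_a = r_b` is fixed by `R`, so `φ (U R t R* U*)`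
commutes with `φ (U r U*) = diag(λ(r))`. For `n ≥ 3` any two positions `i ≠ j` are separated by
`λ(r)` for some such `r`, hence `φ (U R t R* U*)` is diagonal. Its diagonal entries lie in the
finite spectrum of `t` and depend continuously on `R`, so they do not change as `R` is deformed
to the identity. The set of all these `U` is therefore closed and stable under plane rotations,
and, as in Jacobi's eigenvalue algorithm, such a set contains a matrix diagonalizing any given
Hermitian matrix, hence any given normal one.

For `n = 2` the condition `r_a = r_b` makes `r` scalar. There commuting elements have
proportional vector parts as quaternions, which leaves room for a continuous choice of the
conjugating matrix that depends on the maximal torus. -/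

section Diagonalization

open Matrix

variable {m ι : Type*} [Fintype m] [DecidableEq m]

theorem apply_eq_zero_of_commute_diagonal {R : Type*} [CommRing R] [NoZeroDivisors R]
    {A : Matrix m m R} {d : m → R} (h : Commute A (diagonal d)) {i j : m} (hij : d i ≠ d j) :
    A i j = 0 := by
  have hentry : A i j * d j = d i * A i j := by
    simpa only [mul_diagonal, diagonal_mul] using congrFun₂ h.eq i j
  have hzero : (d i - d j) * A i j = 0 := by linear_combination -hentry
  exact (mul_eq_zero.1 hzero).resolve_left (sub_ne_zero.2 hij)

theorem isDiag_of_commute_diagonal {R : Type*} [CommRing R] [NoZeroDivisors R]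
    {A : Matrix m m R} {d : m → R} (hd : Function.Injective d) (h : Commute A (diagonal d)) :
    A.IsDiag :=
  fun _ _ hij => apply_eq_zero_of_commute_diagonal h (hd.ne hij)

theorem charpoly_star_unitary_mul_mul {R : Type*} [CommRing R] [StarRing R]
    (U : unitaryGroup m R) (A : Matrix m m R) :
    (star (U : Matrix m m R) * A * U).charpoly = A.charpoly := by
  rw [mul_assoc, charpoly_mul_comm, mul_assoc, mem_unitaryGroup_iff.1 U.2, mul_one]

theorem charpoly_mul_mul_star_unitary {R : Type*} [CommRing R] [StarRing R]
    (U : unitaryGroup m R) (A : Matrix m m R) :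
    ((U : Matrix m m R) * A * star (U : Matrix m m R)).charpoly = A.charpoly := by
  simpa using charpoly_star_unitary_mul_mul (star U) A

theorem exists_orthonormalBasis_forall_eigenvector {𝕜 E : Type*} [RCLike 𝕜]
    [NormedAddCommGroup E] [InnerProductSpace 𝕜 E] [FiniteDimensional 𝕜 E]
    {T : ι → Module.End 𝕜 E} (hT : ∀ i, (T i).IsSymmetric) (hc : ∀ i j, Commute (T i) (T j)) :
    ∃ (e : OrthonormalBasis (Fin (Module.finrank 𝕜 E)) 𝕜 E)
      (χ : Fin (Module.finrank 𝕜 E) → ι → 𝕜), ∀ i k, T i (e k) = χ k i • e k := by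
  classical
  let V : (ι → 𝕜) → Submodule 𝕜 E := fun χ => ⨅ i, (T i).eigenspace (χ i)
  have hV : OrthogonalFamily 𝕜 (fun χ => V χ) fun χ => (V χ).subtypeₗᵢ :=
    LinearMap.IsSymmetric.orthogonalFamily_iInf_eigenspaces hT
  have : Fintype {χ // V χ ≠ ⊥} :=
    (WellFoundedGT.finite_ne_bot_of_iSupIndep hV.independent).fintype
  have hV' : OrthogonalFamily 𝕜 (fun χ : {χ // V χ ≠ ⊥} => V χ.1) fun χ => (V χ.1).subtypeₗᵢ :=
    hV.comp Subtype.val_injective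
  have hinternal : DirectSum.IsInternal fun χ : {χ // V χ ≠ ⊥} => V χ.1 := by
    rw [hV'.isInternal_iff, iSup_ne_bot_subtype,
      LinearMap.IsSymmetric.iSup_iInf_eq_top_of_commute hT fun i j _ => hc i j,
      Submodule.top_orthogonal_eq_bot]
  refine ⟨hinternal.subordinateOrthonormalBasis rfl hV',
    fun k => (hinternal.subordinateOrthonormalBasisIndex rfl k hV').1, fun i k => ?_⟩
  have hmem := hinternal.subordinateOrthonormalBasis_subordinate rfl k hV'
  exact Module.End.mem_eigenspace_iff.1 ((Submodule.mem_iInf _).1 hmem i)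

theorem exists_unitary_forall_isDiag_of_isHermitian {𝕜 : Type*} [RCLike 𝕜]
    {A : ι → Matrix m m 𝕜} (hA : ∀ i, (A i).IsHermitian) (hc : ∀ i j, Commute (A i) (A j)) :
    ∃ U : unitaryGroup m 𝕜, ∀ i, (star (U : Matrix m m 𝕜) * A i * U).IsDiag := by
  have hcomm (i j : ι) : Commute (A i).toEuclideanLin (A j).toEuclideanLin := by
    change (A i).toEuclideanLin ∘ₗ (A j).toEuclideanLin =
      (A j).toEuclideanLin ∘ₗ (A i).toEuclideanLin
    rw [← toLpLin_mul_same, ← toLpLin_mul_same, (hc i j).eq]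
  obtain ⟨e, χ, he⟩ := exists_orthonormalBasis_forall_eigenvector
    (fun i => isSymmetric_toEuclideanLin_iff.2 (hA i)) hcomm
  let f : m ≃ Fin (Module.finrank 𝕜 (EuclideanSpace 𝕜 m)) :=
    Fintype.equivFinOfCardEq finrank_euclideanSpace.symm
  let U : unitaryGroup m 𝕜 :=
    ⟨(EuclideanSpace.basisFun m 𝕜).toBasis.toMatrix (e.reindex f.symm),
      OrthonormalBasis.toMatrix_orthonormalBasis_mem_unitary _ _⟩
  refine ⟨U, fun i => ?_⟩
  have hAU : A i * U = U * diagonal fun k => χ (f k) i := by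
    ext p k
    have hentry := congrArg (fun v : EuclideanSpace 𝕜 m => v p) (he i (f k))
    simp only [toLpLin_apply, PiLp.smul_apply, mulVec, dotProduct, smul_eq_mul] at hentry
    rw [mul_diagonal]
    simp only [U, mul_apply, Module.Basis.toMatrix_apply,
      OrthonormalBasis.coe_toBasis_repr_apply, EuclideanSpace.basisFun_repr,
      OrthonormalBasis.reindex_apply, Equiv.symm_symm]
    rw [hentry, mul_comm]
  rw [mul_assoc, hAU, ← mul_assoc, UnitaryGroup.star_mul_self, one_mul]
  exact isDiag_diagonal _

open scoped Matrix.Norms.L2Operator in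
theorem exists_unitary_forall_isDiag {A : ι → Matrix m m ℂ} (hA : ∀ i, IsStarNormal (A i))
    (hc : ∀ i j, Commute (A i) (A j)) :
    ∃ U : unitaryGroup m ℂ, ∀ i, (star (U : Matrix m m ℂ) * A i * U).IsDiag := by
  let B : ι × ℂ → Matrix m m ℂ := fun p => p.2 • A p.1 + star p.2 • star (A p.1)
  have hB (p : ι × ℂ) : (B p).IsHermitian := by
    simp only [B, IsHermitian, ← star_eq_conjTranspose, star_add, star_smul, star_star]
    exact add_comm _ _
  have hBc (p q : ι × ℂ) : Commute (B p) (B q) := by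
    -- Fuglede's theorem supplies the mixed commutation relations.
    have hstar (i j : ι) : Commute (A i) (star (A j)) := (hA j).commute_star_right (hc i j)
    refine .add_left (.add_right ?_ ?_) (.add_right ?_ ?_) <;>
      refine .smul_left (.smul_right ?_ _) _
    exacts [hc _ _, hstar _ _, (hstar _ _).symm, (hc _ _).star_star]
  obtain ⟨U, hU⟩ := exists_unitary_forall_isDiag_of_isHermitian hB hBc
  refine ⟨U, fun i => ?_⟩
  have hparts : A i = (1 / 2 : ℂ) • (B (i, 1) - Complex.I • B (i, Complex.I)) := by
    simp only [B, smul_add, smul_smul, one_smul, Complex.I_mul_I, RCLike.star_def, map_one,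
      Complex.conj_I, mul_neg, neg_neg]
    module
  rw [hparts, mul_smul_comm, smul_mul_assoc, mul_sub, sub_mul, mul_smul_comm, smul_mul_assoc]
  exact ((hU _).sub ((hU _).smul _)).smul _

theorem exists_isHermitian_separable_charpoly_commute {X : Matrix m m ℂ} (hX : IsStarNormal X) :
    ∃ Y : Matrix m m ℂ, Y.IsHermitian ∧ Y.charpoly.Separable ∧ Commute X Y := by
  obtain ⟨V, hV⟩ := exists_unitary_forall_isDiag (A := fun _ : Unit => X) (fun _ => hX)
    fun _ _ => .refl X
  let c := Unitary.conjStarAlgAut ℂ (Matrix m m ℂ) V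
  let d : m → ℂ := fun i => (Fintype.equivFin m i : ℕ)
  have hd : Function.Injective d :=
    Nat.cast_injective.comp (Fin.val_injective.comp (Fintype.equivFin m).injective)
  refine ⟨c (diagonal d), ?_, ?_, ?_⟩
  · have hstar : star (diagonal d) = diagonal d := by
      simp [d, star_eq_conjTranspose, diagonal_conjTranspose, Pi.star_def]
    rw [IsHermitian, ← star_eq_conjTranspose, ← map_star, hstar]
  · rw [Unitary.conjStarAlgAut_apply, charpoly_mul_mul_star_unitary, charpoly_diagonal]
    exact Polynomial.separable_prod_X_sub_C_iff.2 hd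
  · have hcX : c (star (V : Matrix m m ℂ) * X * V) = X := c.apply_symm_apply X
    rw [← hcX, ← (hV ()).diagonal_diag]
    exact (commute_diagonal _ _).map c

theorem isDiag_conj_of_commute {X Y : Matrix m m ℂ} (hY : Y.charpoly.Separable)
    (hXY : Commute X Y) {U : unitaryGroup m ℂ} (hU : (star (U : Matrix m m ℂ) * Y * U).IsDiag) :
    (star (U : Matrix m m ℂ) * X * U).IsDiag := by
  have hdistinct : Function.Injective (star (U : Matrix m m ℂ) * Y * U).diag := by
    rw [← Polynomial.separable_prod_X_sub_C_iff, ← charpoly_diagonal, hU.diagonal_diag,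
      charpoly_star_unitary_mul_mul]
    exact hY
  refine isDiag_of_commute_diagonal hdistinct ?_
  rw [hU.diagonal_diag]
  simpa using hXY.map (Unitary.conjStarAlgAut ℂ (Matrix m m ℂ) (star U))

end Diagonalization

section PlaneRotation

open Matrix

variable {m : Type*} [DecidableEq m]

/-- The skew-Hermitian matrix supported on the entries `(a, b)` and `(b, a)`, with entry `w` at
`(a, b)`: an infinitesimal rotation of the coordinate plane spanned by the `a`-th and the `b`-th
basis vector. -/
def planeSkew (a b : m) (w : ℂ) : Matrix m m ℂ :=
  single a b w - single b a (star w)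

theorem planeSkew_zero (a b : m) : planeSkew a b 0 = 0 := by
  simp [planeSkew]

theorem star_planeSkew (a b : m) (w : ℂ) : star (planeSkew a b w) = -planeSkew a b w := by
  simp [planeSkew, star_eq_conjTranspose, conjTranspose_single]

theorem planeSkew_real_smul (a b : m) (θ : ℝ) (w : ℂ) :
    planeSkew a b (θ • w) = θ • planeSkew a b w := by
  simp [planeSkew, smul_sub, smul_single]

theorem continuous_planeSkew (a b : m) : Continuous (planeSkew a b) := by
  refine continuous_matrix fun i j => ?_
  simp only [planeSkew, Matrix.sub_apply, single_apply]
  split_ifs <;> fun_prop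

variable [Fintype m]

theorem commute_planeSkew_diagonal {a b : m} (w : ℂ) {d : m → ℂ} (hd : d a = d b) :
    Commute (planeSkew a b w) (diagonal d) := by
  ext i j
  rw [mul_diagonal, diagonal_mul]
  simp only [planeSkew, Matrix.sub_apply, single_apply]
  grind

theorem trace_diagonal_mul_commutator_planeSkew {B : Matrix m m ℂ} (hB : B.IsHermitian)
    (d : m → ℂ) (a b : m) :
    (diagonal d * (B * planeSkew a b (B a b) - planeSkew a b (B a b) * B)).trace =
      2 * (d b - d a) * Complex.normSq (B a b) := by
  have hba : B b a = star (B a b) := (hB.apply b a).symm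
  have hcycle (Z : Matrix m m ℂ) : (diagonal d * (B * Z - Z * B)).trace =
      (Z * (diagonal d * B)).trace - (Z * (B * diagonal d)).trace := by
    rw [mul_sub, trace_sub, ← mul_assoc, trace_mul_comm, trace_mul_comm (diagonal d) (Z * B),
      mul_assoc Z]
  rw [hcycle]
  simp only [planeSkew, sub_mul, trace_sub, trace_single_mul, smul_eq_mul, diagonal_mul,
    mul_diagonal, hba, Complex.normSq_eq_conj_mul_self, RCLike.star_def]
  ring

open scoped Matrix.Norms.L2Operator in
theorem exp_planeSkew_mem_unitaryGroup (a b : m) (w : ℂ) :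
    NormedSpace.exp (planeSkew a b w) ∈ unitaryGroup m ℂ :=
  letI := NormedAlgebra.restrictScalars ℚ ℂ (Matrix m m ℂ)
  NormedSpace.exp_mem_unitary_of_mem_skewAdjoint
    (skewAdjoint.mem_iff.2 (star_planeSkew a b w))

/-- The unitary matrix `exp (planeSkew a b w)`. It rotates the coordinate plane spanned by the
`a`-th and the `b`-th basis vector and fixes the other basis vectors. -/
noncomputable def planeRotation (a b : m) (w : ℂ) : unitaryGroup m ℂ :=
  ⟨NormedSpace.exp (planeSkew a b w), exp_planeSkew_mem_unitaryGroup a b w⟩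

theorem coe_planeRotation (a b : m) (w : ℂ) :
    (planeRotation a b w : Matrix m m ℂ) = NormedSpace.exp (planeSkew a b w) := rfl

theorem planeRotation_zero (a b : m) : planeRotation a b 0 = 1 :=
  Subtype.ext (by simp [planeRotation, planeSkew_zero])

open scoped Matrix.Norms.L2Operator in
theorem continuous_planeRotation (a b : m) : Continuous (planeRotation a b) :=
  letI := NormedAlgebra.restrictScalars ℚ ℂ (Matrix m m ℂ)
  (NormedSpace.exp_continuous.comp (continuous_planeSkew a b)).subtype_mk _

theorem commute_planeRotation_diagonal {a b : m} (w : ℂ) {d : m → ℂ} (hd : d a = d b) :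
    Commute (planeRotation a b w : Matrix m m ℂ) (diagonal d) :=
  (commute_planeSkew_diagonal w hd).exp_left

end PlaneRotation

section Jacobi

open Matrix

theorem hasDerivAt_exp_neg_smul_mul_mul_exp_smul {𝕂 𝔸 : Type*} [RCLike 𝕂] [NormedRing 𝔸]
    [NormedAlgebra 𝕂 𝔸] [CompleteSpace 𝔸] (z b : 𝔸) :
    HasDerivAt (fun t : 𝕂 => NormedSpace.exp (-(t • z)) * b * NormedSpace.exp (t • z))
      (b * z - z * b) 0 := by
  have hpos := hasDerivAt_exp_smul_const z (0 : 𝕂)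
  have hneg := hasDerivAt_exp_smul_const (-z) (0 : 𝕂)
  simpa [sub_eq_add_neg, add_comm] using! (hneg.mul_const b).mul hpos

variable {m : Type*} [Fintype m] [DecidableEq m]

theorem isCompact_unitaryGroup (𝕜 : Type*) [RCLike 𝕜] :
    IsCompact (unitaryGroup m 𝕜 : Set (Matrix m m 𝕜)) := by
  refine IsCompact.of_isClosed_subset
    (isCompact_univ_pi fun _ => isCompact_univ_pi fun _ => isCompact_closedBall (0 : 𝕜) 1)
    isClosed_unitary fun U hU i _ j _ => ?_
  simpa using entry_norm_bound_of_unitary hU i j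

/-- The real number `Re tr (diag(d) U* Y U)`. For Hermitian `Y` and injective `d`, the critical
points of this function of `U` are the unitary matrices that diagonalize `Y`. -/
noncomputable def weightedTrace (d : m → ℝ) (Y : Matrix m m ℂ) (U : unitaryGroup m ℂ) : ℝ :=
  (diagonal (fun i => (d i : ℂ)) * (star (U : Matrix m m ℂ) * Y * U)).trace.re

theorem weightedTrace_mul (d : m → ℝ) (Y : Matrix m m ℂ) (U V : unitaryGroup m ℂ) :
    weightedTrace d Y (U * V) = weightedTrace d (star (U : Matrix m m ℂ) * Y * U) V := by
  simp only [weightedTrace, Submonoid.coe_mul, star_mul, mul_assoc]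

theorem continuous_weightedTrace (d : m → ℝ) (Y : Matrix m m ℂ) :
    Continuous (weightedTrace d Y) := by
  unfold weightedTrace
  fun_prop

open scoped Matrix.Norms.L2Operator in
theorem hasDerivAt_weightedTrace_planeRotation {B : Matrix m m ℂ} (hB : B.IsHermitian)
    (d : m → ℝ) (a b : m) :
    HasDerivAt (fun θ : ℝ => weightedTrace d B (planeRotation a b (θ • B a b)))
      (2 * (d b - d a) * Complex.normSq (B a b)) 0 := by
  let L : Matrix m m ℂ →L[ℝ] ℝ := LinearMap.toContinuousLinearMap
    (Complex.reLm ∘ₗ traceLinearMap m ℝ ℂ ∘ₗ LinearMap.mulLeft ℝ (diagonal fun i => (d i : ℂ)))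
  have hL (M : Matrix m m ℂ) : L M = (diagonal (fun i => (d i : ℂ)) * M).trace.re := rfl
  have hderiv := L.hasFDerivAt.comp_hasDerivAt (0 : ℝ)
    (hasDerivAt_exp_neg_smul_mul_mul_exp_smul (planeSkew a b (B a b)) B)
  have hvalue : L (B * planeSkew a b (B a b) - planeSkew a b (B a b) * B) =
      2 * (d b - d a) * Complex.normSq (B a b) := by
    rw [hL, trace_diagonal_mul_commutator_planeSkew hB]
    norm_cast
  rw [← hvalue]
  refine hderiv.congr_of_eventuallyEq (.of_forall fun θ => ?_)
  simp only [weightedTrace, coe_planeRotation, NormedSpace.star_exp, hL, Function.comp_apply,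
    ← planeSkew_real_smul, ← star_planeSkew]

theorem exists_mem_isDiag_of_mul_planeRotation_mem {S : Set (unitaryGroup m ℂ)}
    (hclosed : IsClosed S) (hne : S.Nonempty)
    (hrot : ∀ U ∈ S, ∀ a b, a ≠ b → ∀ w, U * planeRotation a b w ∈ S)
    {Y : Matrix m m ℂ} (hY : Y.IsHermitian) :
    ∃ U ∈ S, (star (U : Matrix m m ℂ) * Y * U).IsDiag := by
  have : CompactSpace (unitaryGroup m ℂ) :=
    isCompact_iff_compactSpace.1 (isCompact_unitaryGroup ℂ)
  let d : m → ℝ := fun i => (Fintype.equivFin m i : ℕ)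
  have hd : Function.Injective d :=
    Nat.cast_injective.comp (Fin.val_injective.comp (Fintype.equivFin m).injective)
  obtain ⟨U, hU, hmax⟩ :=
    hclosed.isCompact.exists_isMaxOn hne (continuous_weightedTrace d Y).continuousOn
  refine ⟨U, hU, fun a b hab => ?_⟩
  have hB : (star (U : Matrix m m ℂ) * Y * U).IsHermitian :=
    isHermitian_conjTranspose_mul_mul (U : Matrix m m ℂ) hY
  set B := star (U : Matrix m m ℂ) * Y * U
  have hlocal : IsLocalMax (fun θ : ℝ => weightedTrace d B (planeRotation a b (θ • B a b))) 0 :=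
    .of_forall fun θ => by
      simpa [B, ← weightedTrace_mul, planeRotation_zero] using hmax (hrot U hU a b hab _)
  have hzero := hlocal.hasDerivAt_eq_zero (hasDerivAt_weightedTrace_planeRotation hB d a b)
  simpa [sub_eq_zero, hd.eq_iff, hab.symm] using hzero

end Jacobi

section SpectralSelection

open Matrix

variable {n : ℕ}

theorem spectralAngles_eq {X : SU n} {x : Fin n → ℝ} (h : IsSpectralAngles (X : Mat n) x) :
    spectralAngles X = x :=
  (existsUnique_spectralAngles X).unique (spectralAngles_spec X) h

theorem charpoly_roots_eq_map_spectralSelection (X : SU n) :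
    (X : Mat n).charpoly.roots = Finset.univ.val.map (spectralSelection X) :=
  (spectralAngles_spec X).spec

theorem spectralSelection_eq_of_charpoly_eq {X Y : SU n}
    (h : (X : Mat n).charpoly = (Y : Mat n).charpoly) :
    spectralSelection X = spectralSelection Y := by
  have hY := spectralAngles_spec Y
  have hangles : spectralAngles X = spectralAngles Y :=
    spectralAngles_eq ⟨hY.mono, hY.width, hY.sum_eq_zero, h ▸ hY.spec⟩
  ext j
  rw [spectralSelection, spectralSelection, hangles]

theorem spectralSelection_eq_cos_add_sin (X : SU n) (j : Fin n) :
    spectralSelection X j = Real.cos (2 * Real.pi * spectralAngles X j) +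
      Real.sin (2 * Real.pi * spectralAngles X j) * Complex.I := by
  rw [Complex.ofReal_cos, Complex.ofReal_sin, ← Complex.exp_mul_I, spectralSelection]
  push_cast
  ring_nf

theorem spectrum_eq_range_spectralSelection (X : SU n) :
    spectrum ℂ (X : Mat n) = Set.range (spectralSelection X) := by
  ext z
  rw [mem_spectrum_iff_isRoot_charpoly, ← Polynomial.mem_roots (charpoly_monic _).ne_zero,
    charpoly_roots_eq_map_spectralSelection]
  simp

theorem trace_eq_sum_spectralSelection (X : SU n) :
    (X : Mat n).trace = ∑ j, spectralSelection X j := by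
  rw [trace_eq_sum_roots_charpoly, charpoly_roots_eq_map_spectralSelection]
  rfl

end SpectralSelection

section UnitaryConj

open Matrix

variable {n : ℕ}

theorem isStarNormal_coe (X : SU n) : IsStarNormal (X : Mat n) :=
  isStarNormal_of_mem_unitary (specialUnitaryGroup_le_unitaryGroup X.2)

theorem unitary_mul_mul_star_mem_specialUnitaryGroup (U : unitaryGroup (Fin n) ℂ) (X : SU n) :
    (U : Mat n) * X * star (U : Mat n) ∈ specialUnitaryGroup (Fin n) ℂ := by
  refine mem_specialUnitaryGroup_iff.2
    ⟨mul_mem (mul_mem U.2 (specialUnitaryGroup_le_unitaryGroup X.2)) (star U).2, ?_⟩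
  rw [det_mul_right_comm, mem_unitaryGroup_iff.1 U.2, one_mul]
  exact (mem_specialUnitaryGroup_iff.1 X.2).2

/-- Conjugation `X ↦ U X U*` by a unitary matrix, as an automorphism of the topological group
`SU(n)`. -/
def unitaryConj (U : unitaryGroup (Fin n) ℂ) : SU n ≃ₜ* SU n where
  toFun X := ⟨U * X * star (U : Mat n), unitary_mul_mul_star_mem_specialUnitaryGroup U X⟩
  invFun X := ⟨_, unitary_mul_mul_star_mem_specialUnitaryGroup (star U) X⟩
  left_inv X := Subtype.ext <| by
    simp [← mul_assoc, mul_assoc _ (star (U : Mat n)) (U : Mat n)]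
  right_inv X := Subtype.ext <| by
    simp [← mul_assoc, mul_assoc _ (U : Mat n) (star (U : Mat n))]
  map_mul' X Y := Subtype.ext <| by
    simp [← mul_assoc, mul_assoc _ (star (U : Mat n)) (U : Mat n)]
  continuous_toFun := by fun_prop
  continuous_invFun := by fun_prop

theorem coe_unitaryConj (U : unitaryGroup (Fin n) ℂ) (X : SU n) :
    (unitaryConj U X : Mat n) = U * X * star (U : Mat n) := rfl

theorem unitaryConj_mul (U V : unitaryGroup (Fin n) ℂ) (X : SU n) :
    unitaryConj (U * V) X = unitaryConj U (unitaryConj V X) :=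
  Subtype.ext (by simp [coe_unitaryConj, mul_assoc])

theorem unitaryConj_unitaryConj_star (U : unitaryGroup (Fin n) ℂ) (X : SU n) :
    unitaryConj U (unitaryConj (star U) X) = X :=
  (unitaryConj U).apply_symm_apply X

theorem unitaryConj_eq_self_of_commute {U : unitaryGroup (Fin n) ℂ} {X : SU n}
    (h : Commute (U : Mat n) X) : unitaryConj U X = X :=
  Subtype.ext (by rw [coe_unitaryConj, h.eq, mul_assoc, mem_unitaryGroup_iff.1 U.2, mul_one])

theorem continuous_unitaryConj_left (X : SU n) :
    Continuous fun U : unitaryGroup (Fin n) ℂ => unitaryConj U X :=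
  Continuous.subtype_mk (by fun_prop) _

theorem spectralSelection_unitaryConj (U : unitaryGroup (Fin n) ℂ) (X : SU n) :
    spectralSelection (unitaryConj U X) = spectralSelection X :=
  spectralSelection_eq_of_charpoly_eq (charpoly_mul_mul_star_unitary U X)

theorem spectrum_unitaryConj (U : unitaryGroup (Fin n) ℂ) (X : SU n) :
    spectrum ℂ (unitaryConj U X : Mat n) = spectrum ℂ (X : Mat n) :=
  Unitary.spectrum_star_right_conjugate

end UnitaryConj

section DiagonalTorus

open Matrix

variable {n : ℕ}

/-- The diagonal torus: the subgroup of diagonal matrices in `SU(n)`. -/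
def diagSubgroup (n : ℕ) : Subgroup (SU n) where
  carrier := {X | (X : Mat n).IsDiag}
  one_mem' := isDiag_one
  mul_mem' {X Y} hX hY := by
    change ((X : Mat n) * (Y : Mat n)).IsDiag
    rw [← IsDiag.diagonal_diag hX, ← IsDiag.diagonal_diag hY, diagonal_mul_diagonal]
    exact isDiag_diagonal _
  inv_mem' hX := IsDiag.conjTranspose hX

theorem unitaryConj_star_mem_diagSubgroup_iff {U : unitaryGroup (Fin n) ℂ} {X : SU n} :
    unitaryConj (star U) X ∈ diagSubgroup n ↔ (star (U : Mat n) * X * U).IsDiag := by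
  change (star (U : Mat n) * X * star (star (U : Mat n))).IsDiag ↔ _
  rw [star_star]

theorem coe_eq_diagonal_of_mem_diagSubgroup {X : SU n} (hX : X ∈ diagSubgroup n) :
    (X : Mat n) = diagonal (X : Mat n).diag :=
  (IsDiag.diagonal_diag hX).symm

instance : IsMulCommutative (diagSubgroup n) := .of_setLike_mul_comm fun X hX Y hY => by
  refine Subtype.ext (?_ : (X : Mat n) * (Y : Mat n) = (Y : Mat n) * (X : Mat n))
  rw [coe_eq_diagonal_of_mem_diagSubgroup hX, coe_eq_diagonal_of_mem_diagSubgroup hY]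
  exact commute_diagonal _ _

/-- The diagonal special unitary matrix with diagonal entries `z`. -/
def diagSU (z : Fin n → Circle) (hz : ∏ i, z i = 1) : SU n :=
  ⟨diagonal fun i => (z i : ℂ), by
    rw [mem_specialUnitaryGroup_iff, mem_unitaryGroup_iff, det_diagonal, star_eq_conjTranspose,
      diagonal_conjTranspose, diagonal_mul_diagonal]
    refine ⟨?_, (map_prod Circle.coeHom z Finset.univ).symm.trans (congrArg Circle.coeHom hz)⟩
    simp [Complex.mul_conj]⟩

theorem coe_diagSU (z : Fin n → Circle) (hz : ∏ i, z i = 1) :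
    (diagSU z hz : Mat n) = diagonal fun i => (z i : ℂ) := rfl

theorem diagSU_mem_diagSubgroup (z : Fin n → Circle) (hz : ∏ i, z i = 1) :
    diagSU z hz ∈ diagSubgroup n := isDiag_diagonal _

theorem norm_apply_self_of_mem_diagSubgroup {X : SU n} (hX : X ∈ diagSubgroup n) (i : Fin n) :
    ‖(X : Mat n) i i‖ = 1 := by
  have hunitary := congrFun₂ (mem_unitaryGroup_iff.1 (specialUnitaryGroup_le_unitaryGroup X.2)) i i
  rw [coe_eq_diagonal_of_mem_diagSubgroup hX, star_eq_conjTranspose, diagonal_conjTranspose,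
    diagonal_mul_diagonal, diagonal_apply_eq, one_apply_eq] at hunitary
  have hsq : ‖(X : Mat n) i i‖ ^ 2 = 1 := by
    simpa [Complex.mul_conj', ← Complex.ofReal_pow] using hunitary
  exact (pow_eq_one_iff_of_nonneg (norm_nonneg _) two_ne_zero).1 hsq

/-- The `i`-th diagonal entry of a diagonal special unitary matrix, as a point of the circle. -/
def diagEntry (X : diagSubgroup n) (i : Fin n) : Circle :=
  ⟨(X.1 : Mat n) i i, mem_sphere_zero_iff_norm.2 (norm_apply_self_of_mem_diagSubgroup X.2 i)⟩

theorem coe_diagEntry (X : diagSubgroup n) (i : Fin n) :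
    (diagEntry X i : ℂ) = (X.1 : Mat n) i i := rfl

theorem prod_diagEntry (X : diagSubgroup n) : ∏ i, diagEntry X i = 1 := by
  have hdet := (mem_specialUnitaryGroup_iff.1 X.1.2).2
  rw [coe_eq_diagonal_of_mem_diagSubgroup X.2, det_diagonal] at hdet
  exact Circle.coe_injective ((map_prod Circle.coeHom (diagEntry X) Finset.univ).trans hdet)

/-- A diagonal matrix in `SU(m + 1)` is determined by its diagonal entries other than the first, and
these can be prescribed arbitrarily. -/
noncomputable def diagSubgroupEquiv (m : ℕ) : diagSubgroup (m + 1) ≃ₜ* (Fin m → Circle) where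
  toFun X i := diagEntry X i.succ
  invFun z := ⟨diagSU (Fin.cons (∏ i, z i)⁻¹ z) (by simp [Fin.prod_univ_succ]),
    diagSU_mem_diagSubgroup _ _⟩
  left_inv X := by
    have hentries : Fin.cons (∏ i : Fin m, diagEntry X i.succ)⁻¹ (fun i => diagEntry X i.succ) =
        diagEntry X := by
      have hprod := prod_diagEntry X
      rw [Fin.prod_univ_succ] at hprod
      rw [← eq_inv_of_mul_eq_one_left hprod]
      exact Fin.cons_self_tail (diagEntry X)
    apply Subtype.ext
    apply Subtype.ext
    simp only [coe_diagSU, hentries]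
    exact (coe_eq_diagonal_of_mem_diagSubgroup X.2).symm
  right_inv z := by
    ext i
    simp [coe_diagEntry, coe_diagSU]
  map_mul' X Y := by
    ext i
    have hX := coe_eq_diagonal_of_mem_diagSubgroup X.2
    change ((X.1 : Mat (m + 1)) * (Y.1 : Mat (m + 1))) i.succ i.succ = _
    rw [hX, diagonal_mul]
    rfl
  continuous_toFun := continuous_pi fun i => Continuous.subtype_mk
    ((continuous_subtype_val.comp continuous_subtype_val).matrix_elem _ _) _
  continuous_invFun := by
    refine .subtype_mk (.subtype_mk (.matrix_diagonal (continuous_pi fun i => ?_)) _) _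
    cases i using Fin.cases <;> simp only [Fin.cons_zero, Fin.cons_succ] <;> fun_prop

end DiagonalTorus

section Torus

variable {G G' : Type*} [Group G] [TopologicalSpace G] [Group G'] [TopologicalSpace G']

theorem IsTorus.isMulCommutative {H : Subgroup G} (hH : IsTorus H) : IsMulCommutative H := by
  obtain ⟨k, ⟨e⟩⟩ := hH
  exact .of_comm fun x y => e.injective (by rw [map_mul, map_mul, mul_comm])

theorem IsTorus.map {H : Subgroup G} (hH : IsTorus H) (e : G ≃ₜ* G') :
    IsTorus (H.map (e : G →* G')) := by
  obtain ⟨k, ⟨f⟩⟩ := hH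
  let eH : H ≃ₜ* H.map (e : G →* G') :=
    { e.toMulEquiv.subgroupMap H with
      continuous_toFun := .subtype_mk (e.continuous.comp continuous_subtype_val) _
      continuous_invFun := .subtype_mk (e.symm.continuous.comp continuous_subtype_val) _ }
  exact ⟨k, ⟨eH.symm.trans f⟩⟩

end Torus

section MaximalTorus

open Matrix

variable {n : ℕ}

theorem isTorus_diagSubgroup (n : ℕ) : IsTorus (diagSubgroup n) := by
  cases n with
  | zero =>
    have : Subsingleton (diagSubgroup 0) :=
      (Subtype.val_injective.comp Subtype.val_injective).subsingleton
    have : Unique (diagSubgroup 0) := ⟨⟨1⟩, fun X => Subsingleton.elim X 1⟩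
    exact ⟨0, ⟨.ofUnique⟩⟩
  | succ m => exact ⟨m, ⟨diagSubgroupEquiv m⟩⟩

theorem exists_mem_diagSubgroup_apply_ne {a b : Fin n} (hab : a ≠ b) :
    ∃ t ∈ diagSubgroup n, (t : Mat n) a a ≠ (t : Mat n) b b := by
  let ω : Circle := ⟨Complex.I, mem_sphere_zero_iff_norm.2 Complex.norm_I⟩
  let z : Fin n → Circle := Pi.mulSingle a ω * Pi.mulSingle b ω⁻¹
  have hz : ∏ i, z i = 1 := by
    simp [z, Finset.prod_mul_distrib, Finset.prod_pi_mulSingle']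
  refine ⟨diagSU z hz, diagSU_mem_diagSubgroup z hz, ?_⟩
  have hza : z a = ω := by simp [z, hab]
  have hzb : z b = ω⁻¹ := by simp [z, hab.symm]
  rw [coe_diagSU, diagonal_apply_eq, diagonal_apply_eq, hza, hzb, Circle.coe_inv]
  simp [ω, Complex.inv_I, eq_neg_iff_add_eq_zero, Complex.ext_iff]

theorem isMaximalTorus_diagSubgroup (n : ℕ) : IsMaximalTorus (diagSubgroup n) := by
  refine ⟨isTorus_diagSubgroup n, fun H hH hle X hX a b hab => ?_⟩
  obtain ⟨t, ht, hne⟩ := exists_mem_diagSubgroup_apply_ne hab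
  have := hH.isMulCommutative
  have hcomm : Commute (X : Mat n) t := congrArg Subtype.val (setLike_mul_comm hX (hle ht))
  rw [coe_eq_diagonal_of_mem_diagSubgroup ht] at hcomm
  exact apply_eq_zero_of_commute_diagonal hcomm hne

theorem exists_unitaryConj_mem_diagSubgroup (H : Subgroup (SU n)) [IsMulCommutative H] :
    ∃ U : unitaryGroup (Fin n) ℂ, ∀ X ∈ H, unitaryConj (star U) X ∈ diagSubgroup n := by
  obtain ⟨U, hU⟩ := exists_unitary_forall_isDiag (A := fun X : H => (X : Mat n))
    (fun X => isStarNormal_coe X.1) (fun X Y => congrArg Subtype.val (setLike_mul_comm X.2 Y.2))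
  exact ⟨U, fun X hX => unitaryConj_star_mem_diagSubgroup_iff.2 (hU ⟨X, hX⟩)⟩

theorem IsMaximalTorus.exists_unitaryConj_mem {H : Subgroup (SU n)} (hH : IsMaximalTorus H) :
    ∃ U : unitaryGroup (Fin n) ℂ, ∀ t ∈ diagSubgroup n, unitaryConj U t ∈ H := by
  have := hH.1.isMulCommutative
  obtain ⟨U, hU⟩ := exists_unitaryConj_mem_diagSubgroup H
  have hle : H ≤ (diagSubgroup n).map (unitaryConj U : SU n →* SU n) := fun X hX =>
    ⟨unitaryConj (star U) X, hU X hX, unitaryConj_unitaryConj_star U X⟩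
  exact ⟨U, fun t ht =>
    hH.2 ((isTorus_diagSubgroup n).map (unitaryConj U)) hle ⟨t, ht, rfl⟩⟩

end MaximalTorus

section Separation

open Matrix

variable {n : ℕ}

theorem exists_mem_diagSubgroup_spectralAngles_eq {x : Fin n → ℝ} (hmono : Monotone x)
    (hwidth : ∀ i j, x j ≤ x i + 1) (hsum : ∑ j, x j = 0) (σ : Equiv.Perm (Fin n)) :
    ∃ t ∈ diagSubgroup n, spectralAngles t = x ∧
      ∀ i, (t : Mat n) i i = spectralSelection t (σ i) := by
  let z : Fin n → Circle := fun i => Circle.exp (2 * Real.pi * x (σ i))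
  have hzx (i : Fin n) : (z i : ℂ) = Complex.exp (2 * Real.pi * Complex.I * x (σ i)) := by
    rw [Circle.coe_exp]
    push_cast
    ring_nf
  have hz : ∏ i, z i = 1 := by
    have hcoe : ((∏ i, z i : Circle) : ℂ) = ∏ i, (z i : ℂ) :=
      map_prod Circle.coeHom z Finset.univ
    refine Circle.coe_injective (hcoe.trans ?_)
    simp only [hzx, ← Complex.exp_sum, ← Finset.mul_sum]
    rw [Equiv.sum_comp σ fun j => (x j : ℂ), ← Complex.ofReal_sum, hsum]
    simp
  have hangles : spectralAngles (diagSU z hz) = x := by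
    refine spectralAngles_eq ⟨hmono, hwidth, hsum, ?_⟩
    have hroots := Polynomial.roots_multiset_prod_X_sub_C
      (Finset.univ.val.map fun i => (z i : ℂ))
    rw [Multiset.map_map] at hroots
    rw [coe_diagSU, charpoly_diagonal]
    exact hroots.trans ((map_univ_val_eq_iff _ _).2 ⟨σ, funext hzx⟩)
  refine ⟨diagSU z hz, diagSU_mem_diagSubgroup z hz, hangles, fun i => ?_⟩
  rw [coe_diagSU, diagonal_apply_eq, hzx, spectralSelection, hangles]

/-- Spectral angles taking only two values, half a turn apart, with the jump at position `j`. -/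
noncomputable def stepAngles (j l : Fin n) : ℝ :=
  (if l < j then 0 else 1 / 2) - (n - j) / (2 * n)

theorem monotone_stepAngles (j : Fin n) : Monotone (stepAngles j) := by
  intro l m hlm
  unfold stepAngles
  split_ifs with hl hm hm
  · rfl
  · linarith
  · exact absurd (hlm.trans_lt hm) hl
  · rfl

theorem stepAngles_le_add_one (j l m : Fin n) : stepAngles j m ≤ stepAngles j l + 1 := by
  unfold stepAngles
  split_ifs <;> linarith

theorem sum_stepAngles (j : Fin n) : ∑ l, stepAngles j l = 0 := by
  have hn : (n : ℝ) ≠ 0 := Nat.cast_ne_zero.2 (Fin.pos j).ne'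
  have hcard : ((Finset.univ.filter fun l : Fin n => ¬l < j).card : ℝ) = n - j := by
    simp only [not_lt, Finset.filter_le_eq_Ici, Fin.card_Ici]
    exact Nat.cast_sub j.2.le
  simp only [stepAngles, Finset.sum_sub_distrib, Finset.sum_ite, Finset.sum_const, nsmul_eq_mul,
    hcard, Finset.card_univ, Fintype.card_fin]
  field_simp
  ring

theorem exists_ne_stepAngles_eq (hn : 3 ≤ n) (j : Fin n) :
    ∃ p q, p ≠ q ∧ stepAngles j p = stepAngles j q := by
  obtain ⟨p, q, hne, hside⟩ := Fintype.exists_ne_map_eq_of_card_lt (fun l => decide (l < j))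
    (by rwa [Fintype.card_bool, Fintype.card_fin])
  exact ⟨p, q, hne, by simp only [stepAngles, decide_eq_decide.1 hside]⟩

theorem exists_perm_apply_eq {α : Type*} {a b p q : α} (hab : a ≠ b) (hpq : p ≠ q) :
    ∃ σ : Equiv.Perm α, σ a = p ∧ σ b = q :=
  MulAction.is_two_pretransitive_iff.1 (Equiv.Perm.isMultiplyPretransitive α 2) hab hpq

theorem spectralSelection_ne_of_spectralAngles_eq_add_half {X : SU n} {i j : Fin n}
    (h : spectralAngles X j = spectralAngles X i + 1 / 2) :
    spectralSelection X i ≠ spectralSelection X j := by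
  have hneg : spectralSelection X j = -spectralSelection X i := by
    rw [spectralSelection, h, spectralSelection, ← mul_neg_one, ← Complex.exp_pi_mul_I,
      ← Complex.exp_add]
    push_cast
    ring_nf
  rw [hneg]
  exact self_ne_neg.2 (Complex.exp_ne_zero _)

theorem exists_mem_diagSubgroup_separating (hn : 3 ≤ n) {a b i j : Fin n} (hab : a ≠ b)
    (hij : i ≠ j) :
    ∃ t ∈ diagSubgroup n, (t : Mat n) a a = (t : Mat n) b b ∧
      spectralSelection t i ≠ spectralSelection t j := by
  wlog hlt : i < j generalizing i j
  · obtain ⟨t, ht, hta, hne⟩ := this hij.symm (hij.lt_or_gt.resolve_left hlt)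
    exact ⟨t, ht, hta, hne.symm⟩
  obtain ⟨p, q, hpq, hpq_angle⟩ := exists_ne_stepAngles_eq hn j
  obtain ⟨σ, hσa, hσb⟩ := exists_perm_apply_eq hab hpq
  obtain ⟨t, ht, hangles, hentry⟩ := exists_mem_diagSubgroup_spectralAngles_eq
    (monotone_stepAngles j) (stepAngles_le_add_one j) (sum_stepAngles j) σ
  refine ⟨t, ht, ?_, spectralSelection_ne_of_spectralAngles_eq_add_half ?_⟩
  · rw [hentry, hentry, hσa, hσb, spectralSelection, spectralSelection, hangles, hpq_angle]
  · rw [hangles, stepAngles, stepAngles, if_pos hlt, if_neg (lt_irrefl j)]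
    ring

end Separation

section SortedTorus

open Matrix

variable {n : ℕ} {ψ : SU n → Mat n} {U : unitaryGroup (Fin n) ℂ}

/-- `ψ` lists the spectral selection, in order and along the diagonal, on the maximal torus obtained
from the diagonal torus by conjugation with `U`. -/
def SortsTorus (ψ : SU n → Mat n) (U : unitaryGroup (Fin n) ℂ) : Prop :=
  ∀ t ∈ diagSubgroup n, ψ (unitaryConj U t) = diagonal (spectralSelection t)

theorem isClosed_setOf_sortsTorus (hcont : Continuous ψ) : IsClosed {U | SortsTorus ψ U} := by
  simp only [SortsTorus, Set.ofPred_forall]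
  exact isClosed_iInter fun t => isClosed_iInter fun _ =>
    isClosed_eq (hcont.comp (continuous_unitaryConj_left t)) continuous_const

theorem SortsTorus.isDiag_apply_mul_planeRotation (hU : SortsTorus ψ U) (hn : 3 ≤ n)
    (hcomm : CommutativityPreserving ψ) {a b : Fin n} (hab : a ≠ b) (w : ℂ) {t : SU n}
    (ht : t ∈ diagSubgroup n) : (ψ (unitaryConj (U * planeRotation a b w) t)).IsDiag := by
  intro i j hij
  obtain ⟨r, hr, hrab, hne⟩ := exists_mem_diagSubgroup_separating hn hab hij
  have hfix : unitaryConj (planeRotation a b w) r = r := unitaryConj_eq_self_of_commute <| by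
    rw [coe_eq_diagonal_of_mem_diagSubgroup hr]
    exact commute_planeRotation_diagonal w hrab
  have hψr : ψ (unitaryConj (U * planeRotation a b w) r) = diagonal (spectralSelection r) := by
    rw [unitaryConj_mul, hfix, hU r hr]
  have hcommute : Commute (ψ (unitaryConj (U * planeRotation a b w) t))
      (diagonal (spectralSelection r)) := by
    rw [← hψr]
    exact hcomm _ _ (by rw [← map_mul, ← map_mul, setLike_mul_comm ht hr])
  exact apply_eq_zero_of_commute_diagonal hcommute hne

theorem apply_self_mem_spectrum_of_isDiag {A : Mat n} (hA : A.IsDiag) (i : Fin n) :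
    A i i ∈ spectrum ℂ A := by
  rw [← hA.diagonal_diag, spectrum_diagonal, diagonal_apply_eq]
  exact Set.mem_range_self i

theorem SortsTorus.mul_planeRotation (hU : SortsTorus ψ U) (hn : 3 ≤ n) (hcont : Continuous ψ)
    (hspec : SpectrumPreserving ψ) (hcomm : CommutativityPreserving ψ) {a b : Fin n}
    (hab : a ≠ b) (w : ℂ) : SortsTorus ψ (U * planeRotation a b w) := by
  intro t ht
  let f : ℂ → Mat n := fun v => ψ (unitaryConj (U * planeRotation a b v) t)
  have hf : Continuous f := hcont.comp
    ((continuous_unitaryConj_left t).comp (continuous_const.mul (continuous_planeRotation a b)))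
  have hdiag (v : ℂ) : (f v).IsDiag := hU.isDiag_apply_mul_planeRotation hn hcomm hab v ht
  have hmem (i : Fin n) (v : ℂ) : f v i i ∈ spectrum ℂ (t : Mat n) := by
    rw [← spectrum_unitaryConj (U * planeRotation a b v) t, ← hspec]
    exact apply_self_mem_spectrum_of_isDiag (hdiag v) i
  have hconst (i : Fin n) : f w i i = f 0 i i :=
    isPreconnected_univ.constant_of_mapsTo (Matrix.finite_spectrum (t : Mat n)).isDiscrete
      (hf.matrix_elem i i).continuousOn (fun v _ => hmem i v) (Set.mem_univ w) (Set.mem_univ 0)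
  calc f w = f 0 := by
        rw [← (hdiag w).diagonal_diag, ← (hdiag 0).diagonal_diag]
        exact congrArg diagonal (funext hconst)
    _ = diagonal (spectralSelection t) := by
        simp only [f, planeRotation_zero, mul_one]
        exact hU t ht

theorem SortsTorus.apply_eq_of_isDiag (hU : SortsTorus ψ U) {X : SU n}
    (hX : (star (U : Mat n) * X * U).IsDiag) : ψ X = diagonal (spectralSelection X) := by
  rw [← spectralSelection_unitaryConj (star U) X,
    ← hU _ (unitaryConj_star_mem_diagSubgroup_iff.2 hX), unitaryConj_unitaryConj_star]

theorem SortsTorus.apply_eq (hU : SortsTorus ψ U) (hn : 3 ≤ n) (hcont : Continuous ψ)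
    (hspec : SpectrumPreserving ψ) (hcomm : CommutativityPreserving ψ) (X : SU n) :
    ψ X = diagonal (spectralSelection X) := by
  obtain ⟨Y, hY, hsep, hXY⟩ :=
    exists_isHermitian_separable_charpoly_commute (isStarNormal_coe X)
  obtain ⟨V, hV, hVY⟩ := exists_mem_isDiag_of_mul_planeRotation_mem
    (isClosed_setOf_sortsTorus hcont) ⟨U, hU⟩
    (fun V hV a b hab w => SortsTorus.mul_planeRotation hV hn hcont hspec hcomm hab w) hY
  exact SortsTorus.apply_eq_of_isDiag hV (isDiag_conj_of_commute hsep hXY hVY)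

end SortedTorus

section Reordering

open Matrix

variable {n : ℕ}

theorem conjBy_inv_conjBy (T : GL (Fin n) ℂ) (A : Mat n) : conjBy T⁻¹ (conjBy T A) = A := by
  simp [conjBy, mul_assoc]

theorem conjBy_conjBy_inv (T : GL (Fin n) ℂ) (A : Mat n) : conjBy T (conjBy T⁻¹ A) = A := by
  simp [conjBy, mul_assoc]

theorem conjBy_mul (T : GL (Fin n) ℂ) (A B : Mat n) :
    conjBy T (A * B) = conjBy T A * conjBy T B := by
  simp [conjBy, mul_assoc]

theorem continuous_conjBy (T : GL (Fin n) ℂ) : Continuous (conjBy T) := by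
  unfold conjBy
  fun_prop

theorem CommutativityPreserving.conjBy {φ : SU n → Mat n} (hφ : CommutativityPreserving φ)
    (T : GL (Fin n) ℂ) : CommutativityPreserving fun X => conjBy T (φ X) := fun X Y hXY => by
  rw [← conjBy_mul, ← conjBy_mul, hφ X Y hXY]

theorem SpectrumPreserving.conjBy {φ : SU n → Mat n} (hφ : SpectrumPreserving φ)
    (T : GL (Fin n) ℂ) : SpectrumPreserving fun X => conjBy T (φ X) := fun X =>
  spectrum.units_conjugate.trans (hφ X)

theorem isSelectionType_of_reordersOn (hn : 3 ≤ n) {φ : SU n → Mat n} (hcont : Continuous φ)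
    (hspec : SpectrumPreserving φ) (hcomm : CommutativityPreserving φ) {H : Subgroup (SU n)}
    (hH : IsMaximalTorus H) (hφ : ReordersOn φ H) : IsSelectionType φ := by
  obtain ⟨T, hT⟩ := hφ
  obtain ⟨U, hU⟩ := hH.exists_unitaryConj_mem
  have hsorts : SortsTorus (fun X => conjBy T⁻¹ (φ X)) U := fun t ht => by
    simp only [hT _ (hU t ht), conjBy_inv_conjBy, spectralSelection_unitaryConj]
  refine ⟨T, fun X => ?_⟩
  rw [← hsorts.apply_eq hn ((continuous_conjBy T⁻¹).comp hcont) (hspec.conjBy T⁻¹)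
    (hcomm.conjBy T⁻¹) X, conjBy_conjBy_inv]

end Reordering

section ReordersOn

open Matrix

variable {n : ℕ} {φ : SU n → Mat n}

theorem spectrumPreserving_of_reordersOn
    (hφ : ∀ (H : Subgroup (SU n)) [IsMulCommutative H], ReordersOn φ H) :
    SpectrumPreserving φ := fun X => by
  obtain ⟨T, hT⟩ := hφ (Subgroup.zpowers X)
  rw [hT X (Subgroup.mem_zpowers X), spectrum_eq_range_spectralSelection, conjBy,
    spectrum.units_conjugate, spectrum_diagonal]

theorem commutativityPreserving_of_reordersOn
    (hφ : ∀ (H : Subgroup (SU n)) [IsMulCommutative H], ReordersOn φ H) :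
    CommutativityPreserving φ := fun X Y hXY => by
  have : IsMulCommutative (Subgroup.closure {X, Y}) :=
    Subgroup.isMulCommutative_closure (by grind)
  obtain ⟨T, hT⟩ := hφ (Subgroup.closure {X, Y})
  rw [hT X (Subgroup.subset_closure (by simp)), hT Y (Subgroup.subset_closure (by simp)),
    ← conjBy_mul, ← conjBy_mul, commute_diagonal]

end ReordersOn

section SUTwo

open Matrix

theorem star_eq_adjugate {m R : Type*} [Fintype m] [DecidableEq m] [CommRing R] [StarRing R]
    (X : specialUnitaryGroup m R) : star (X : Matrix m m R) = (X : Matrix m m R).adjugate := by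
  have hunitary := mem_unitaryGroup_iff'.1 (specialUnitaryGroup_le_unitaryGroup X.2)
  have hadjugate := mul_adjugate (X : Matrix m m R)
  rw [(mem_specialUnitaryGroup_iff.1 X.2).2, one_smul] at hadjugate
  exact left_inv_eq_right_inv hunitary hadjugate

theorem apply_one_one_eq_star (X : SU 2) : (X : Mat 2) 1 1 = star ((X : Mat 2) 0 0) := by
  simpa [adjugate_fin_two] using (congrFun₂ (star_eq_adjugate X) 0 0).symm

theorem apply_one_zero_eq_neg_star (X : SU 2) : (X : Mat 2) 1 0 = -star ((X : Mat 2) 0 1) := by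
  have hentry : star ((X : Mat 2) 0 1) = -(X : Mat 2) 1 0 := by
    simpa [adjugate_fin_two] using congrFun₂ (star_eq_adjugate X) 1 0
  rw [hentry, neg_neg]

theorem trace_eq_two_mul_re (X : SU 2) : (X : Mat 2).trace = 2 * ((X : Mat 2) 0 0).re := by
  rw [trace_fin_two, apply_one_one_eq_star, RCLike.star_def, Complex.add_conj]
  push_cast
  rfl

/-- The sine of the rotation angle of `X ∈ SU(2)`, that is, the norm of the vector part of the unit
quaternion corresponding to `X`, whose real part is `Re X₀₀`. -/
noncomputable def angleSin (X : SU 2) : ℝ :=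
  √(((X : Mat 2) 0 0).im ^ 2 + ‖(X : Mat 2) 0 1‖ ^ 2)

theorem angleSin_nonneg (X : SU 2) : 0 ≤ angleSin X := Real.sqrt_nonneg _

theorem angleSin_sq (X : SU 2) :
    angleSin X ^ 2 = ((X : Mat 2) 0 0).im ^ 2 + ‖(X : Mat 2) 0 1‖ ^ 2 :=
  Real.sq_sqrt (by positivity)

theorem re_sq_add_angleSin_sq (X : SU 2) : ((X : Mat 2) 0 0).re ^ 2 + angleSin X ^ 2 = 1 := by
  have hdet := (mem_specialUnitaryGroup_iff.1 X.2).2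
  rw [det_fin_two, apply_one_one_eq_star, apply_one_zero_eq_neg_star, mul_neg, sub_neg_eq_add,
    RCLike.star_def, Complex.mul_conj', Complex.mul_conj'] at hdet
  have hnorm : ‖(X : Mat 2) 0 0‖ ^ 2 + ‖(X : Mat 2) 0 1‖ ^ 2 = 1 := by exact_mod_cast hdet
  rw [angleSin_sq, ← hnorm, Complex.sq_norm ((X : Mat 2) 0 0), Complex.normSq_apply]
  ring

theorem spectralSelection_zero_add_one (X : SU 2) :
    spectralSelection X 0 + spectralSelection X 1 = 2 * ((X : Mat 2) 0 0).re := by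
  rw [← Fin.sum_univ_two, ← trace_eq_sum_spectralSelection, trace_eq_two_mul_re]

theorem spectralSelection_one_eq (X : SU 2) :
    spectralSelection X 1 = ((X : Mat 2) 0 0).re + angleSin X * Complex.I := by
  have hx := spectralAngles_spec X
  have hneg : spectralAngles X 0 = -spectralAngles X 1 :=
    eq_neg_of_add_eq_zero_left (by simpa using hx.sum_eq_zero)
  have hmono := hx.mono (Fin.zero_le 1)
  have hwidth := hx.width 0 1
  set θ := 2 * Real.pi * spectralAngles X 1 with hθ
  have hone : spectralSelection X 1 = Real.cos θ + Real.sin θ * Complex.I :=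
    spectralSelection_eq_cos_add_sin X 1
  have hzero : spectralSelection X 0 = Real.cos θ - Real.sin θ * Complex.I := by
    rw [spectralSelection_eq_cos_add_sin, hneg, mul_neg, ← hθ, Real.cos_neg, Real.sin_neg]
    push_cast
    ring
  have hcos : Real.cos θ = ((X : Mat 2) 0 0).re := by
    have hsum := spectralSelection_zero_add_one X
    rw [hzero, hone] at hsum
    have hcos' : (Real.cos θ : ℂ) = ((X : Mat 2) 0 0).re := by linear_combination hsum / 2
    exact_mod_cast hcos'
  have hsin : Real.sin θ = angleSin X := by
    refine (sq_eq_sq₀ (Real.sin_nonneg_of_nonneg_of_le_pi ?_ ?_) (angleSin_nonneg X)).1 ?_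
    · exact mul_nonneg Real.two_pi_pos.le (by linarith)
    · nlinarith [Real.pi_pos]
    · rw [Real.sin_sq, hcos, ← re_sq_add_angleSin_sq X, add_sub_cancel_left]
  rw [hone, hcos, hsin]

theorem spectralSelection_zero_eq (X : SU 2) :
    spectralSelection X 0 = ((X : Mat 2) 0 0).re - angleSin X * Complex.I := by
  have hsum := spectralSelection_zero_add_one X
  rw [spectralSelection_one_eq] at hsum
  linear_combination hsum

theorem im_mul_apply_zero_one_comm {X Y : SU 2} (h : X * Y = Y * X) :
    (((X : Mat 2) 0 0).im : ℂ) * (Y : Mat 2) 0 1 = ((Y : Mat 2) 0 0).im * (X : Mat 2) 0 1 := by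
  have hcomm : (X : Mat 2) * (Y : Mat 2) = (Y : Mat 2) * (X : Mat 2) := congrArg Subtype.val h
  have hentry := congrFun₂ hcomm 0 1
  rw [mul_apply, mul_apply, Fin.sum_univ_two, Fin.sum_univ_two, apply_one_one_eq_star,
    apply_one_one_eq_star, RCLike.star_def] at hentry
  have hX := Complex.sub_conj ((X : Mat 2) 0 0)
  have hY := Complex.sub_conj ((Y : Mat 2) 0 0)
  push_cast at hX hY
  refine mul_left_cancel₀ (mul_ne_zero two_ne_zero Complex.I_ne_zero) ?_
  linear_combination hentry - (Y : Mat 2) 0 1 * hX + (X : Mat 2) 0 1 * hY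

theorem norm_mul_angleSin_comm {X Y : SU 2} (h : X * Y = Y * X) :
    ‖(X : Mat 2) 0 1‖ * angleSin Y = ‖(Y : Mat 2) 0 1‖ * angleSin X := by
  have hnorm := congrArg (fun z : ℂ => ‖z‖ ^ 2) (im_mul_apply_zero_one_comm h)
  simp only [norm_mul, Complex.norm_real, mul_pow, Real.norm_eq_abs, sq_abs] at hnorm
  rw [← sq_eq_sq₀ (mul_nonneg (norm_nonneg _) (angleSin_nonneg _))
    (mul_nonneg (norm_nonneg _) (angleSin_nonneg _)), mul_pow, mul_pow, angleSin_sq, angleSin_sq]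
  linear_combination -hnorm

theorem exists_norm_eq_mul_angleSin (H : Subgroup (SU 2)) [IsMulCommutative H] :
    ∃ κ : ℝ, ∀ X ∈ H, ‖(X : Mat 2) 0 1‖ = κ * angleSin X := by
  by_cases hH : ∃ Y ∈ H, angleSin Y ≠ 0
  · obtain ⟨Y, hY, hY0⟩ := hH
    refine ⟨‖(Y : Mat 2) 0 1‖ / angleSin Y, fun X hX => ?_⟩
    rw [div_mul_eq_mul_div, eq_div_iff hY0, norm_mul_angleSin_comm (setLike_mul_comm hX hY)]
  · push Not at hH
    refine ⟨0, fun X hX => ?_⟩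
    have hsq := angleSin_sq X
    rw [hH X hX] at hsq
    nlinarith [sq_nonneg ((X : Mat 2) 0 0).im]

/-- The continuous map `SU(2) → M₂` that reorders on every maximal torus but not globally. The norm
appears, and not the entry itself, because the latter changes sign under inversion, in contrast to
`λ₁ - λ₀ = 2i angleSin`. -/
noncomputable def toralReordering (X : SU 2) : Mat 2 :=
  !![spectralSelection X 0, ‖(X : Mat 2) 0 1‖; 0, spectralSelection X 1]

theorem continuous_toralReordering : Continuous toralReordering := by
  have hentry (j : Fin 2) : Continuous fun X : SU 2 => (X : Mat 2) 0 j :=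
    continuous_subtype_val.matrix_elem 0 j
  have hre := Complex.continuous_re.comp (hentry 0)
  have him := Complex.continuous_im.comp (hentry 0)
  have hnorm := (hentry 1).norm
  have hsin : Continuous angleSin := ((him.pow 2).add (hnorm.pow 2)).sqrt
  have hzero : Continuous fun X : SU 2 => spectralSelection X 0 := by
    simp only [spectralSelection_zero_eq]
    fun_prop
  have hone : Continuous fun X : SU 2 => spectralSelection X 1 := by
    simp only [spectralSelection_one_eq]
    fun_prop
  exact continuous_matrix (Fin.forall_fin_two.2
    ⟨Fin.forall_fin_two.2 ⟨hzero, Complex.continuous_ofReal.comp hnorm⟩,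
      Fin.forall_fin_two.2 ⟨continuous_const, hone⟩⟩)

theorem reordersOn_toralReordering (H : Subgroup (SU 2)) [IsMulCommutative H] :
    ReordersOn toralReordering H := by
  obtain ⟨κ, hκ⟩ := exists_norm_eq_mul_angleSin H
  -- The off-diagonal entry of `T diag(λ₀, λ₁) T⁻¹` is `τ (λ₁ - λ₀) = 2i τ angleSin X`.
  let τ : ℂ := -(κ / 2) * Complex.I
  let T : GL (Fin 2) ℂ := ⟨!![1, τ; 0, 1], !![1, -τ; 0, 1], by simp [one_fin_two],
    by simp [one_fin_two]⟩
  refine ⟨T, fun X hX => ?_⟩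
  have hdiag : diagonal (spectralSelection X) =
      !![spectralSelection X 0, 0; 0, spectralSelection X 1] := by
    rw [eta_fin_two (diagonal _)]
    simp
  have hcorner : (‖(X : Mat 2) 0 1‖ : ℂ) =
      τ * (spectralSelection X 1 - spectralSelection X 0) := by
    rw [hκ X hX, spectralSelection_zero_eq, spectralSelection_one_eq]
    push_cast
    linear_combination κ * (angleSin X : ℂ) * Complex.I_sq
  change toralReordering X = !![1, τ; 0, 1] * diagonal (spectralSelection X) * !![1, -τ; 0, 1]
  rw [hdiag, toralReordering, hcorner, mul_fin_two, mul_fin_two]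
  ring_nf

theorem not_isSelectionType_toralReordering : ¬IsSelectionType toralReordering := by
  rintro ⟨T, hT⟩
  let J : SU 2 := ⟨!![0, -1; 1, 0], by
    rw [mem_specialUnitaryGroup_iff, mem_unitaryGroup_iff, det_fin_two_of, eta_fin_two (star _)]
    simp [one_fin_two]⟩
  obtain ⟨U, hU⟩ := exists_unitaryConj_mem_diagSubgroup (Subgroup.zpowers J)
  have hsame : toralReordering (unitaryConj (star U) J) = toralReordering J := by
    rw [hT, hT, spectralSelection_unitaryConj]
  have hzero : (unitaryConj (star U) J : Mat 2) 0 1 = 0 :=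
    hU J (Subgroup.mem_zpowers J) zero_ne_one
  have hcorner := congrFun₂ hsame 0 1
  simp [toralReordering, hzero, J] at hcorner

end SUTwo

theorem proposition1p13 :
    (∀ (n : ℕ), 3 ≤ n → ∀ φ : SU n → Mat n,
      Continuous φ → SpectrumPreserving φ → CommutativityPreserving φ →
      (∃ H : Subgroup (SU n), IsMaximalTorus H ∧ ReordersOn φ H) →
      IsSelectionType φ) ∧
    (∃ φ : SU 2 → Mat 2,
      Continuous φ ∧ SpectrumPreserving φ ∧ CommutativityPreserving φ ∧
      (∃ H : Subgroup (SU 2), IsMaximalTorus H) ∧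
      (∀ H : Subgroup (SU 2), IsMaximalTorus H → ReordersOn φ H) ∧
      ¬ IsSelectionType φ) := by
  refine ⟨fun n hn φ hcont hspec hcomm ⟨H, hH, hφ⟩ =>
    isSelectionType_of_reordersOn hn hcont hspec hcomm hH hφ, toralReordering,
    continuous_toralReordering, spectrumPreserving_of_reordersOn reordersOn_toralReordering,
    commutativityPreserving_of_reordersOn reordersOn_toralReordering,
    ⟨diagSubgroup 2, isMaximalTorus_diagSubgroup 2⟩, fun H hH => ?_,
    not_isSelectionType_toralReordering⟩
  have := hH.1.isMulCommutative
  exact reordersOn_toralReordering H
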